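/- A poset $P$ is called \emph{reversible} if every order preserving bijection $P\to P$ is an order automorphism. Let $P\sqcup Q$ denote the disjoint union of posets, $P\oplus Q$ their linear sum (every element of $P$ lies below every element of $Q$), $P^d$ the dual of $P$, $\omega$ the least infinite ordinal, $D_\infty$ the antichain of cardinality $\aleph_0$, and $D_n$ the antichain with $n$ elements. Put \begin{align*} F_1&=D_\infty\sqcup\omega, & F_2&=(D_1\oplus D_\infty)\sqcup D_\infty, & F_3&=D_\infty\sqcup\bigsqcup_{i=0}^{\infty}(D_1\oplus D_1),\\ F_4&=D_\infty\oplus\omega, & F_5&=(D_1\sqcup\omega^d)\oplus\omega, & F_6&=L\oplus\omega, \end{align*} where $L=\cdots\oplus D_2\oplus D_2\oplus D_2$ is the linear sum of copies of $D_2$ indexed by $\omega^d$. Let $F_7=\{c_j\}_{j\ge 0}\cup\{d_i\}_{i\ge 1}$ (all these elements distinct) with strict order given exactly by $c_i<c_j$ for $i<j$ and $d_i<c_j$ for $i\le j$. Let $F_8=\{a_i\}_{i\in\mathbb Z}\cup\{b_i\}_{i\in\mathbb Z}$ (all these elements distinct) with strict order given exactly by $a_i<b_j$ whenever $i>0$ or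 $j\ne i$. \textbf{Theorem.} If $P$ is a poset that is not reversible, then $P$ contains a subset that, with the induced order, is isomorphic to $F_i$ or to $F_i^d$ for some $i\in\{1,\dots,8\}$. -/

import Mathlib

namespace ReversiblePoset

/-- A poset is reversible if every order preserving bijective self-map is an order automorphism. -/
def Reversible (P : Type*) [PartialOrder P] : Prop :=
  ∀ f : P → P, Monotone f → Function.Bijective f → ∃ e : P ≃o P, ⇑e = f

/-- `P` contains a subset which, with the induced order, is isomorphic to `Q`. -/
def ContainsCopy (P Q : Type*) [PartialOrder P] [PartialOrder Q] : Prop :=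
  ∃ S : Set P, Nonempty (S ≃o Q)

/-- The antichain on the underlying set `α`. -/
structure AntichainOn (α : Type*) where
  val : α

instance {α : Type*} : PartialOrder (AntichainOn α) where
  le x y := x = y
  le_refl _ := rfl
  le_trans _ _ _ h k := Eq.trans h k
  le_antisymm _ _ h _ := h

/-- The one-element poset `D₁`. -/
abbrev D1 : Type := Unit

/-- The two-element antichain. -/
abbrev D2 : Type := AntichainOn (Fin 2)

/-- The countably infinite antichain `D_∞`. -/
abbrev Dinf : Type := AntichainOn ℕ

/- `α ⊕ β` is the disjoint union of posets, `α ⊕ₗ β` the linear sum (`α` below `β`),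
`Σ _ : ℕ, α` the disjoint union of countably many copies of `α`, `ℕ` is `ω`, `ℕᵒᵈ` is its dual. -/

/-- `D_∞ ⊔ ω`. -/
abbrev F1 : Type := Dinf ⊕ ℕ

/-- `(D₁ ⊕ D_∞) ⊔ D_∞`. -/
abbrev F2 : Type := (D1 ⊕ₗ Dinf) ⊕ Dinf

/-- `D_∞ ⊔ ⨆ᵢ (D₁ ⊕ D₁)`, with countably many two-element chains. -/
abbrev F3 : Type := Dinf ⊕ (Σ _ : ℕ, D1 ⊕ₗ D1)

/-- `D_∞ ⊕ ω` (linear sum). -/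
abbrev F4 : Type := Dinf ⊕ₗ ℕ

/-- `(D₁ ⊔ ω^d) ⊕ ω`. -/
abbrev F5 : Type := (D1 ⊕ ℕᵒᵈ) ⊕ₗ ℕ

/-- An infinite descending sequence of two-element antichains, each one lying entirely above
the next (the lexicographic product of `ω^d` and `D₂`), with a copy of `ω` put on top. -/
abbrev F6 : Type := (ℕᵒᵈ ×ₗ D2) ⊕ₗ ℕ

/-- The vertices of `F₇`: a chain `c 0 < c 1 < ⋯` and minimal elements `d 0, d 1, …`. -/
inductive F7 : Type
  | c : ℕ → F7
  | d : ℕ → F7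

/-- The order of `F₇`: besides the chain relations, `d i` is covered by `c (i + 1)`. -/
def F7.le : F7 → F7 → Prop
  | .c i, .c j => i ≤ j
  | .d i, .c j => i + 1 ≤ j
  | .d i, .d j => i = j
  | .c _, .d _ => False

instance : PartialOrder F7 where
  le := F7.le
  le_refl x := by cases x <;> simp [F7.le]
  le_trans x y z h k := by
    cases x <;> cases y <;> cases z <;> simp only [F7.le] at h k ⊢ <;> omega
  le_antisymm x y h k := by
    cases x <;> cases y <;> simp only [F7.le, F7.c.injEq, F7.d.injEq] at h k ⊢ <;> omega

/-- The vertices of `F₈`. -/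
inductive F8 : Type
  | a : ℤ → F8
  | b : ℤ → F8

/-- The order of `F₈`: `a i < b j` iff `i > 0` or `j ≠ i`; no other two distinct elements are
comparable. -/
def F8.le : F8 → F8 → Prop
  | .a i, .b j => 0 < i ∨ j ≠ i
  | .a i, .a j => i = j
  | .b i, .b j => i = j
  | .b _, .a _ => False

instance : PartialOrder F8 where
  le := F8.le
  le_refl x := by cases x <;> simp [F8.le]
  le_trans x y z h k := by
    cases x <;> cases y <;> cases z <;> simp only [F8.le] at h k ⊢ <;> omega
  le_antisymm x y h k := by
    cases x <;> cases y <;> simp only [F8.le, F8.a.injEq, F8.b.injEq] at h k ⊢ <;> omega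

/-- `P` contains a subset isomorphic to `Q` or to the dual of `Q`. -/
def ContainsCopyOrDual (P Q : Type*) [PartialOrder P] [PartialOrder Q] : Prop :=
  ContainsCopy P Q ∨ ContainsCopy P Qᵒᵈ

end ReversiblePoset

namespace ReversiblePoset

/-! A monotone bijection `e` that is not an automorphism yields points p, q with e p ≤ e q but not p
≤ q. On the orbits x i = e^i p and y i = e^i q, indexed by ℤ, comparabilities persist under forward
shifts, and x k < y k holds exactly for k ≥ 1 (`Crossing`). The forbidden poset is found inside
these two sequences.

Each orbit is periodic or injective. If an injective orbit gains a comparability under a shift, it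
already contains a forbidden poset (`hasForbidden_of_single`). Otherwise z i ≤ z j depends only on j
- i, and some arithmetic progression of indices makes the orbit constant, a chain or an antichain
(`exists_tame_sample`). A crossing survives such sampling, so sixteen pairs of types remain
(`Crossing.hasForbidden`); four contradict the crossing and duality pairs up many of the others. Up
to duality, a constant gives `F2` or `F5`, two chains give `F5` or `F6`, an antichain with a chain
gives `F1`, `F4` or `F7`, and two antichains give `F2`, `F3` or `F8`. -/

/-- `P` contains one of the posets `F1`, …, `F8` or a dual of one of them. -/
def HasForbidden (P : Type*) [PartialOrder P] : Prop :=
  ContainsCopyOrDual P F1 ∨ ContainsCopyOrDual P F2 ∨ ContainsCopyOrDual P F3 ∨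
  ContainsCopyOrDual P F4 ∨ ContainsCopyOrDual P F5 ∨ ContainsCopyOrDual P F6 ∨
  ContainsCopyOrDual P F7 ∨ ContainsCopyOrDual P F8

/-! ### Recognising each forbidden poset from sequences of points -/

section Copies

variable {P Q : Type*} [PartialOrder P] [PartialOrder Q]

theorem containsCopy_iff : ContainsCopy P Q ↔ Nonempty (Q ↪o P) := by
  constructor
  · rintro ⟨S, ⟨e⟩⟩
    exact ⟨e.symm.toOrderEmbedding.trans (OrderEmbedding.subtype _)⟩
  · rintro ⟨g⟩
    exact ⟨Set.range g, ⟨g.orderIso.symm⟩⟩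

theorem ContainsCopyOrDual.of_le_iff (g : Q → P) (h : ∀ a b, g a ≤ g b ↔ a ≤ b) :
    ContainsCopyOrDual P Q :=
  Or.inl (containsCopy_iff.2 ⟨OrderEmbedding.ofMapLEIff g h⟩)

theorem ContainsCopyOrDual.of_dual (h : ContainsCopyOrDual Pᵒᵈ Q) : ContainsCopyOrDual P Q := by
  rcases h with h | h <;> obtain ⟨g⟩ := containsCopy_iff.1 h
  · exact Or.inr (containsCopy_iff.2
      ⟨OrderEmbedding.ofMapLEIff (fun a => OrderDual.ofDual (g (OrderDual.ofDual a)))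
        fun _ _ => g.le_iff_le⟩)
  · exact Or.inl (containsCopy_iff.2
      ⟨OrderEmbedding.ofMapLEIff (fun a => OrderDual.ofDual (g (OrderDual.toDual a)))
        fun _ _ => g.le_iff_le⟩)

theorem HasForbidden.of_dual (h : HasForbidden Pᵒᵈ) : HasForbidden P := by
  rcases h with h | h | h | h | h | h | h | h <;> have h := h.of_dual <;>
    simp only [HasForbidden, h, true_or, or_true]

theorem AntichainOn.le_iff {α : Type*} {x y : AntichainOn α} : x ≤ y ↔ x.val = y.val := by
  cases x; cases y
  exact AntichainOn.mk.injEq _ _ ▸ Iff.rfl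

theorem hasForbidden_of_F1 (a c : ℕ → P) (ha : ∀ i j, a i ≤ a j → i = j) (hc : StrictMono c)
    (hac : ∀ i j, ¬ a i ≤ c j) (hca : ∀ i j, ¬ c j ≤ a i) : HasForbidden P := by
  refine Or.inl (ContainsCopyOrDual.of_le_iff (Sum.elim (fun n => a n.val) c) ?_)
  rintro (x | x) (y | y)
  · simpa [AntichainOn.le_iff] using ⟨ha _ _, fun h => (congrArg a h).le⟩
  · simpa using hac _ _
  · simpa using hca _ _
  · simpa using hc.le_iff_le

theorem hasForbidden_of_F2 (p : P) (a b : ℕ → P) (ha : ∀ i j, a i ≤ a j → i = j)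
    (hb : ∀ i j, b i ≤ b j → i = j) (hpb : ∀ i, p < b i) (hpa : ∀ i, ¬ p ≤ a i)
    (hap : ∀ i, ¬ a i ≤ p) (hab : ∀ i j, ¬ a i ≤ b j) (hba : ∀ i j, ¬ b j ≤ a i) :
    HasForbidden P := by
  refine Or.inr (Or.inl (ContainsCopyOrDual.of_le_iff
    (Sum.elim (fun z => Sum.elim (fun _ => p) (fun n => b n.val) (ofLex z))
      (fun n => a n.val)) ?_))
  rintro (x | x) (y | y)
  · obtain ⟨x | x, rfl⟩ := toLex.surjective x <;> obtain ⟨y | y, rfl⟩ := toLex.surjective y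
    · simp
    · simpa using (hpb _).le
    · simpa using (hpb _).not_ge
    · simpa [AntichainOn.le_iff] using ⟨hb _ _, fun h => (congrArg b h).le⟩
  · obtain ⟨x | x, rfl⟩ := toLex.surjective x
    · simpa using hpa _
    · simpa using hba _ _
  · obtain ⟨y | y, rfl⟩ := toLex.surjective y
    · simpa using hap _
    · simpa using hab _ _
  · simpa [AntichainOn.le_iff] using ⟨ha _ _, fun h => (congrArg a h).le⟩

theorem hasForbidden_of_F3 (a u v : ℕ → P) (ha : ∀ i j, a i ≤ a j → i = j)
    (hu : ∀ i j, u i ≤ u j → i = j) (hv : ∀ i j, v i ≤ v j → i = j)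
    (huv : ∀ i j, u i ≤ v j ↔ i = j) (hvu : ∀ i j, ¬ v i ≤ u j)
    (hau : ∀ i j, ¬ a i ≤ u j) (hua : ∀ i j, ¬ u i ≤ a j)
    (hav : ∀ i j, ¬ a i ≤ v j) (hva : ∀ i j, ¬ v i ≤ a j) : HasForbidden P := by
  refine Or.inr (Or.inr (Or.inl (ContainsCopyOrDual.of_le_iff
    (Sum.elim (fun n => a n.val)
      (fun z => Sum.elim (fun _ => u z.1) (fun _ => v z.1) (ofLex z.2))) ?_)))
  rintro (x | ⟨m, x⟩) (y | ⟨n, y⟩)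
  · simpa [AntichainOn.le_iff] using ⟨ha _ _, fun h => (congrArg a h).le⟩
  · obtain ⟨y | y, rfl⟩ := toLex.surjective y
    · simpa using hau _ _
    · simpa using hav _ _
  · obtain ⟨x | x, rfl⟩ := toLex.surjective x
    · simpa using hua _ _
    · simpa using hva _ _
  · obtain ⟨x | x, rfl⟩ := toLex.surjective x <;> obtain ⟨y | y, rfl⟩ := toLex.surjective y <;>
      by_cases h : m = n
    · subst h; simp
    · simpa [Sigma.le_def, h] using fun h' => h (hu _ _ h')
    · subst h; simpa using (huv _ _).2 rfl
    · simpa [Sigma.le_def, h] using fun h' => h ((huv _ _).1 h')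
    · subst h; simpa using hvu _ _
    · simpa [Sigma.le_def, h] using hvu _ _
    · subst h; simp
    · simpa [Sigma.le_def, h] using fun h' => h (hv _ _ h')

theorem hasForbidden_of_F4 (a c : ℕ → P) (ha : ∀ i j, a i ≤ a j → i = j) (hc : StrictMono c)
    (hac : ∀ i j, a i < c j) : HasForbidden P := by
  refine Or.inr (Or.inr (Or.inr (Or.inl (ContainsCopyOrDual.of_le_iff
    (fun z => Sum.elim (fun n => a n.val) c (ofLex z)) ?_))))
  intro x y
  obtain ⟨x | x, rfl⟩ := toLex.surjective x <;> obtain ⟨y | y, rfl⟩ := toLex.surjective y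
  · simpa [AntichainOn.le_iff] using ⟨ha _ _, fun h => (congrArg a h).le⟩
  · simpa using (hac _ _).le
  · simpa using (hac _ _).not_ge
  · simpa using hc.le_iff_le

theorem hasForbidden_of_F5 (p : P) (e c : ℕ → P) (he : StrictAnti e) (hc : StrictMono c)
    (hpe : ∀ i, ¬ p ≤ e i) (hep : ∀ i, ¬ e i ≤ p) (hpc : p < c 0) (hec : e 0 < c 0) :
    HasForbidden P := by
  have hpc' (j) : p < c j := hpc.trans_le (hc.monotone j.zero_le)
  have hec' (i j) : e i < c j :=
    (he.antitone i.zero_le).trans_lt (hec.trans_le (hc.monotone j.zero_le))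
  refine Or.inr (Or.inr (Or.inr (Or.inr (Or.inl (ContainsCopyOrDual.of_le_iff
    (fun z => Sum.elim (Sum.elim (fun _ => p) (fun n => e (OrderDual.ofDual n))) c (ofLex z))
      ?_)))))
  intro x y
  obtain ⟨(x | x) | x, rfl⟩ := toLex.surjective x <;>
    obtain ⟨(y | y) | y, rfl⟩ := toLex.surjective y
  · simp
  · simpa using hpe _
  · simpa using (hpc' _).le
  · simpa using hep _
  · simpa using he.le_iff_ge.trans OrderDual.ofDual_le_ofDual
  · simpa using (hec' _ _).le
  · simpa using (hpc' _).not_ge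
  · simpa using (hec' _ _).not_ge
  · simpa using hc.le_iff_le

theorem hasForbidden_of_F6 (w : ℕ → Fin 2 → P) (c : ℕ → P)
    (hw : ∀ n s t, w n s ≤ w n t → s = t) (hlt : ∀ n s t, w (n + 1) s < w n t)
    (hc : StrictMono c) (hwc : ∀ s, w 0 s < c 0) : HasForbidden P := by
  have hlt' : ∀ m n, n < m → ∀ s t, w m s < w n t := by
    intro m n h
    induction m, h using Nat.le_induction with
    | base => exact hlt n
    | succ m _ ih => exact fun s t => (hlt m s 0).trans (ih 0 t)
  have hwc' (n s j) : w n s < c j := by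
    refine lt_of_lt_of_le ?_ (hc.monotone j.zero_le)
    rcases n.eq_zero_or_pos with rfl | hn
    · exact hwc s
    · exact (hlt' n 0 hn s 0).trans (hwc 0)
  refine Or.inr (Or.inr (Or.inr (Or.inr (Or.inr (Or.inl (ContainsCopyOrDual.of_le_iff
    (fun z => Sum.elim
      (fun u : ℕᵒᵈ ×ₗ D2 => w (OrderDual.ofDual (ofLex u).1) (ofLex u).2.val) c (ofLex z))
      ?_))))))
  intro x y
  obtain ⟨x | x, rfl⟩ := toLex.surjective x <;> obtain ⟨y | y, rfl⟩ := toLex.surjective y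
  · obtain ⟨⟨m, s⟩, rfl⟩ := toLex.surjective x
    obtain ⟨⟨n, t⟩, rfl⟩ := toLex.surjective y
    obtain ⟨m, rfl⟩ := OrderDual.toDual.surjective m
    obtain ⟨n, rfl⟩ := OrderDual.toDual.surjective n
    simp only [Sum.Lex.inl_le_inl_iff, Prod.Lex.toLex_le_toLex, ofLex_toLex, Sum.elim_inl,
      OrderDual.ofDual_toDual, OrderDual.toDual_lt_toDual, AntichainOn.le_iff,
      OrderDual.toDual_inj]
    rcases lt_trichotomy m n with h | rfl | h
    · simpa [h.ne, h.not_gt] using (hlt' n m h t.val s.val).not_ge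
    · simpa using ⟨hw m _ _, fun h => (congrArg (w m) h).le⟩
    · simpa [h] using (hlt' m n h s.val t.val).le
  · simpa using (hwc' _ _ _).le
  · simpa using (hwc' _ _ _).not_ge
  · simpa using hc.le_iff_le

theorem hasForbidden_of_F7 (c d : ℕ → P) (hc : StrictMono c) (hd : ∀ i j, d i ≤ d j → i = j)
    (hdc : ∀ i j, d i ≤ c j ↔ i + 1 ≤ j) (hcd : ∀ i j, ¬ c i ≤ d j) : HasForbidden P := by
  refine Or.inr (Or.inr (Or.inr (Or.inr (Or.inr (Or.inr (Or.inl (ContainsCopyOrDual.of_le_iff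
    (fun z => match z with | .c i => c i | .d i => d i) ?_)))))))
  rintro (i | i) (j | j)
  · exact hc.le_iff_le
  · exact iff_of_false (hcd _ _) id
  · exact hdc _ _
  · exact ⟨hd _ _, fun h => (congrArg d h).le⟩

theorem hasForbidden_of_F8 (a b : ℤ → P) (ha : ∀ i j, a i ≤ a j → i = j)
    (hb : ∀ i j, b i ≤ b j → i = j) (hab : ∀ i j, a i ≤ b j ↔ 0 < i ∨ j ≠ i)
    (hba : ∀ i j, ¬ b i ≤ a j) : HasForbidden P := by
  refine Or.inr (Or.inr (Or.inr (Or.inr (Or.inr (Or.inr (Or.inr (ContainsCopyOrDual.of_le_iff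
    (fun z => match z with | .a i => a i | .b i => b i) ?_)))))))
  rintro (i | i) (j | j)
  · exact ⟨ha _ _, fun h => (congrArg a h).le⟩
  · exact hab _ _
  · exact iff_of_false (hba _ _) id
  · exact ⟨hb _ _, fun h => (congrArg b h).le⟩

end Copies

/-! ### One shift-monotone sequence -/

section Sequences

variable {P : Type*} [PartialOrder P]

/-- An infinite antichain together with an `ω`-chain none of whose elements lies below an element
of the antichain contains `F1`, `F4` or `F7`. -/
theorem hasForbidden_of_antichain_chain (a c : ℕ → P) (ha : ∀ i j, a i ≤ a j → i = j)
    (hc : StrictMono c) (hca : ∀ i j, ¬ c j ≤ a i) : HasForbidden P := by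
  by_cases h₁ : {i | ∀ j, ¬ a i ≤ c j}.Infinite
  · have g := h₁.natEmbedding
    exact hasForbidden_of_F1 (fun n => a (g n)) c
      (fun i j h => g.injective (Subtype.ext (ha _ _ h))) hc (fun i j => (g i).2 j)
      fun i j => hca _ _
  by_cases h₂ : ∃ j, {i | a i ≤ c j}.Infinite
  · obtain ⟨j, hj⟩ := h₂
    have g := hj.natEmbedding
    refine hasForbidden_of_F4 (fun n => a (g n)) (fun n => c (j + n))
      (fun i j h => g.injective (Subtype.ext (ha _ _ h)))
      (fun m n h => hc (by omega)) fun i k => lt_of_le_not_ge ?_ (hca _ _)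
    exact le_trans (g i).2 (hc.monotone (by omega))
  push Not at h₂
  -- Only finitely many `a i` are below no `c j` or below `c J`; any other one first falls below the
  -- chain strictly after `J`. Iterating `N` spaces the chain so that each chosen `a i` enters
  -- between consecutive terms, as in `F7`.
  have step (J : ℕ) : ∃ i J', J < J' ∧ ¬ a i ≤ c J ∧ a i ≤ c J' := by
    obtain ⟨i, hi⟩ := ((Set.not_infinite.1 h₁).union (h₂ J)).exists_notMem
    simp only [Set.mem_union, Set.mem_ofPred_eq, not_or, not_forall, not_not] at hi
    obtain ⟨⟨k, hk⟩, hJ⟩ := hi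
    refine ⟨i, k, lt_of_not_ge fun hkJ => hJ (hk.trans (hc.monotone hkJ)), hJ, hk⟩
  choose i N hN hi₁ hi₂ using step
  let J : ℕ → ℕ := fun n => N^[n] 0
  have hJsucc (n) : J (n + 1) = N (J n) := Function.iterate_succ_apply' _ _ _
  have hJ : StrictMono J := strictMono_nat_of_lt_succ fun n => by rw [hJsucc]; exact hN _
  have hdc (k j) : a (i (J k)) ≤ c (J j) ↔ k + 1 ≤ j := by
    refine ⟨fun h => ?_, fun h => ?_⟩
    · by_contra hjk
      exact hi₁ (J k) (h.trans (hc.monotone (hJ.monotone (by omega))))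
    · refine (hi₂ (J k)).trans (hc.monotone ?_)
      rw [← hJsucc]
      exact hJ.monotone h
  refine hasForbidden_of_F7 (fun n => c (J n)) (fun n => a (i (J n))) (hc.comp hJ) ?_ hdc
    fun _ _ => hca _ _
  intro k l h
  have h := ha _ _ h
  have h₁ := (hdc k (l + 1)).1 (h ▸ (hdc l (l + 1)).2 le_rfl)
  have h₂ := (hdc l (k + 1)).1 (h ▸ (hdc k (k + 1)).2 le_rfl)
  omega

/-- Comparabilities `x i ≤ y j` survive simultaneous shifts of the indices by one. -/
def ShiftMono (x y : ℤ → P) : Prop :=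
  ∀ i j, x i ≤ y j → x (i + 1) ≤ y (j + 1)

theorem ShiftMono.add_nat {x y : ℤ → P} (h : ShiftMono x y) (n : ℕ) {i j : ℤ} (hij : x i ≤ y j) :
    x (i + n) ≤ y (j + n) := by
  induction n with
  | zero => simpa using hij
  | succ n ih => simpa [add_assoc] using h _ _ ih

theorem ShiftMono.of_le {x y : ℤ → P} (h : ShiftMono x y) {i j k l : ℤ} (hij : x i ≤ y j)
    (hik : i ≤ k) (hkl : l - k = j - i) : x k ≤ y l := by
  obtain ⟨n, rfl⟩ := Int.le.dest hik
  obtain rfl : l = j + n := by omega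
  exact h.add_nat n hij

theorem ShiftMono.sample {x y : ℤ → P} (h : ShiftMono x y) (b : ℤ) {m : ℤ} (hm : 0 < m) :
    ShiftMono (fun k => x (b + m * k)) (fun k => y (b + m * k)) :=
  fun i j hij => h.of_le hij (by nlinarith) (by ring)

theorem ShiftMono.dual {x y : ℤ → P} (h : ShiftMono x y) :
    ShiftMono (fun i => OrderDual.toDual (y i)) (fun i => OrderDual.toDual (x i)) :=
  fun i j hij => h j i hij

/-- Two families of pairwise incomparable points, coinitial in each other, below an `ω`-chain. -/
theorem hasForbidden_of_pairs (u v : ℤ → P) (c : ℕ → P)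
    (hinc : ∀ j ≤ 0, ¬ u j ≤ v j ∧ ¬ v j ≤ u j)
    (hstep : ∀ j ≤ 0, ∃ k ≤ 0, u k < u j ∧ u k < v j ∧ v k < u j ∧ v k < v j)
    (hc : StrictMono c) (huc : u 0 < c 0) (hvc : v 0 < c 0) : HasForbidden P := by
  choose N hN₀ hN using hstep
  let J : ℕ → {j : ℤ // j ≤ 0} := fun n => (fun j => ⟨N j.1 j.2, hN₀ _ _⟩)^[n] ⟨0, le_rfl⟩
  have hJsucc (n) : (J (n + 1)).1 = N (J n).1 (J n).2 :=
    congrArg Subtype.val (Function.iterate_succ_apply' _ _ _)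
  refine hasForbidden_of_F6 (fun n => ![u (J n), v (J n)]) c ?_ ?_ hc ?_
  · intro n s t
    have := hinc _ (J n).2
    fin_cases s <;> fin_cases t <;> simp [this.1, this.2]
  · intro n s t
    obtain ⟨h₁, h₂, h₃, h₄⟩ := hN _ (J n).2
    rw [← hJsucc] at h₁ h₂ h₃ h₄
    fin_cases s <;> fin_cases t <;> simp [*]
  · intro s
    fin_cases s
    · exact huc
    · exact hvc

/-- A shift-monotone sequence whose consecutive terms become comparable only from some index on. -/
theorem hasForbidden_of_single_asc (y : ℤ → P) (hinj : Function.Injective y)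
    (hy : ShiftMono y y) (h₀ : y 0 ≤ y 1) (h₁ : ¬ y (-1) ≤ y 0) : HasForbidden P := by
  have hchain : StrictMono fun n : ℕ => y n := by
    refine strictMono_nat_of_lt_succ fun n => lt_of_le_of_ne (hy.of_le h₀ (by omega) ?_) ?_
    · push_cast; ring
    · exact fun h => by have := hinj h; omega
  have hmono (i j : ℤ) (hi : 0 ≤ i) (hij : i ≤ j) : y i ≤ y j := by
    lift i to ℕ using hi
    lift j to ℕ using by omega
    exact hchain.monotone (by omega)
  -- Shifting both indices into the nonnegative half, where `y` increases strictly, rules out i > j.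
  have dir (i j : ℤ) (h : y i ≤ y j) : i ≤ j := by
    have h := hy.add_nat (i.natAbs + j.natAbs) h
    by_contra hlt
    have h' := hmono (j + (i.natAbs + j.natAbs)) (i + (i.natAbs + j.natAbs)) (by omega) (by omega)
    have := hinj (le_antisymm h (by exact_mod_cast h'))
    omega
  have neg (i : ℤ) (hi : i < 0) : ¬ y i ≤ y (i + 1) :=
    fun h => h₁ (hy.of_le h (by omega) (by ring))
  by_contra hF
  -- An antichain of negative-index terms, together with the chain of nonnegative ones, would
  -- already be forbidden.
  have noanti (g : ℕ → ℤ) (hg : StrictAnti g) (hg0 : g 0 < 0) :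
      ∃ m n, m < n ∧ y (g n) ≤ y (g m) := by
    by_contra! h
    refine hF (hasForbidden_of_antichain_chain (fun n => y (g n)) (fun n => y n) ?_ hchain ?_)
    · intro i j hij
      have hji : j ≤ i := hg.le_iff_ge.1 (dir _ _ hij)
      exact (hji.eq_or_lt.resolve_right fun hlt => h _ _ hlt hij).symm
    · intro i j hji
      have := dir _ _ hji
      have := hg.antitone i.zero_le
      omega
  -- The indices tested lie below i, so the comparability found shifts forward to y i ≤ y (i + d)
  -- with d > 0. Repeating this jump reaches the increasing half.
  have above (i : ℤ) : ∃ L : ℕ, ∀ l : ℤ, L ≤ l → y i < y l := by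
    obtain ⟨m, n, hmn, h⟩ := noanti (fun n => -1 - i.natAbs - n)
      (fun a b hab => by simp only; omega) (by omega)
    obtain ⟨d, hd, hi⟩ : ∃ d : ℕ, 0 < d ∧ y i ≤ y (i + d) :=
      ⟨n - m, by omega, hy.of_le h (by omega) (by omega)⟩
    have hs (s : ℕ) : y i ≤ y (i + d * s) := by
      induction s with
      | zero => simp
      | succ s ih =>
        exact ih.trans (hy.of_le hi (k := i + d * s)
          (le_add_of_nonneg_right (by positivity)) (by push_cast; ring))
    obtain ⟨T, hT, hiT⟩ : ∃ T : ℕ, i.natAbs + 1 ≤ T ∧ y i ≤ y (i + T) :=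
      ⟨d * (i.natAbs + 1), Nat.le_mul_of_pos_left _ hd, by exact_mod_cast hs (i.natAbs + 1)⟩
    refine ⟨T, fun l hl => lt_of_le_of_ne ?_ fun h => ?_⟩
    · obtain hi0 | hi0 := le_total 0 i
      · exact hmono _ _ hi0 (by omega)
      · exact hiT.trans (hmono _ _ (by omega) (by omega))
    · have := hinj h
      omega
  -- Either some `y j` fails to dominate infinitely many earlier terms, which gives `F5`, or every
  -- `y j` with j ≤ 0 dominates all sufficiently early terms, and the incomparable pairs `y j`, `y
  -- (j - 1)` stack up to `F6`.
  by_cases hcase : ∃ j ≤ (0 : ℤ), {n : ℕ | ¬ y (j - 1 - n) ≤ y j}.Infinite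
  · classical
    obtain ⟨j, hj, hinf⟩ := hcase
    have := hinf.to_subtype
    let g := Nat.orderEmbeddingOfSet {n : ℕ | ¬ y (j - 1 - n) ≤ y j}
    have hg (n) : ¬ y (j - 1 - g n) ≤ y j :=
      (Nat.orderEmbeddingOfSet_range {n : ℕ | ¬ y (j - 1 - n) ≤ y j}).subset (Set.mem_range_self n)
    -- Ramsey: a descending subsequence is the ω^d of `F5`; one without any descent is excluded by
    -- `noanti`.
    obtain ⟨g', h | h⟩ := exists_increasing_or_nonincreasing_subseq (fun a b : P => b < a)
      (fun n => y (j - 1 - g n))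
    · obtain ⟨L, hL⟩ := above j
      obtain ⟨L', hL'⟩ := above (j - 1 - g (g' 0))
      refine hF (hasForbidden_of_F5 (y j) (fun n => y (j - 1 - g (g' n)))
        (fun n => y ((L + L' + n : ℕ) : ℤ)) (fun m n hmn => h _ _ hmn)
        (fun m n hmn => hchain (by omega)) (fun n hn => ?_) (fun n => hg _)
        (hL _ (by omega)) (hL' _ (by omega)))
      have := dir _ _ hn
      omega
    · obtain ⟨m, n, hmn, hle⟩ := noanti (fun n => j - 1 - g (g' n))
        (fun a b hab => by
          have := g.strictMono (g'.strictMono hab)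
          simp only; omega) (by omega)
      refine h m n hmn (lt_of_le_of_ne hle fun he => ?_)
      have := hinj he
      have := g.strictMono (g'.strictMono hmn)
      omega
  · push Not at hcase
    have coinit (j : ℤ) (hj : j ≤ 0) : ∃ b : ℤ, ∀ i ≤ b, y i < y j := by
      obtain ⟨M, hM⟩ := (hcase j hj).bddAbove
      refine ⟨j - 2 - M, fun i hi => lt_of_le_of_ne ?_ fun he => ?_⟩
      · by_contra hle
        have := @hM (j - 1 - i).toNat (by
          rw [Set.mem_ofPred_eq, Int.toNat_of_nonneg (by omega)]
          simpa using hle)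
        omega
      · have := hinj he
        omega
    obtain ⟨L, hL⟩ := above 0
    obtain ⟨L', hL'⟩ := above (-1)
    refine hF (hasForbidden_of_pairs y (fun j => y (j - 1)) (fun n => y ((L + L' + n : ℕ) : ℤ))
      (fun j hj => ⟨fun h => ?_, ?_⟩) (fun j hj => ?_) (fun m n hmn => hchain (by omega))
      (hL _ (by omega)) (hL' _ (by omega)))
    · have := dir _ _ h
      omega
    · simpa using neg (j - 1) (by omega)
    · obtain ⟨b, hb⟩ := coinit j hj
      obtain ⟨b', hb'⟩ := coinit (j - 1) (by omega)
      exact ⟨min 0 (min b b'), by omega, hb _ (by omega), hb' _ (by omega), hb _ (by omega),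
        hb' _ (by omega)⟩

theorem hasForbidden_of_single (x : ℤ → P) (hinj : Function.Injective x) (hx : ShiftMono x x)
    {i j : ℤ} (h₀ : ¬ x i ≤ x j) (h₁ : x (i + 1) ≤ x (j + 1)) : HasForbidden P := by
  have key {Q : Type _} [PartialOrder Q] (x : ℤ → Q) (hinj : Function.Injective x)
      (hx : ShiftMono x x) (i j : ℤ) (hij : i < j) (h₀ : ¬ x i ≤ x j)
      (h₁ : x (i + 1) ≤ x (j + 1)) : HasForbidden Q := by
    -- The progression sends 0 and 1 to i + 1 and j + 1; a comparability between its terms -1 and 0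
    -- would shift forward to `x i ≤ x j`.
    refine hasForbidden_of_single_asc (fun k => x (i + 1 + (j - i) * k)) (fun k l hkl => ?_)
      (hx.sample _ (by omega)) ?_ fun h => h₀ (hx.of_le h (by omega) (by ring))
    · exact mul_left_cancel₀ (show j - i ≠ 0 by omega) (add_left_cancel (hinj hkl))
    · convert h₁ using 2 <;> ring
  rcases lt_trichotomy i j with h | rfl | h
  · exact key x hinj hx i j h h₀ h₁
  · exact absurd le_rfl h₀
  · exact HasForbidden.of_dual (key (fun k => OrderDual.toDual (x k)) hinj hx.dual j i h h₀ h₁)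

end Sequences

/-! ### Two sequences: antichains matched by a relation -/

section TwoSequences

theorem orbit_injective_or_periodic {P : Type*} (e : Equiv.Perm P) (p : P) :
    Function.Injective (fun i : ℤ => (e ^ i) p) ∨
      ∃ m : ℤ, 0 < m ∧ ∀ i : ℤ, (e ^ (i + m)) p = (e ^ i) p := by
  refine or_iff_not_imp_left.2 fun h => ?_
  simp only [Function.Injective, not_forall] at h
  obtain ⟨i, j, hij, hne⟩ := h
  wlog hlt : i < j generalizing i j
  · exact this j i hij.symm (Ne.symm hne) (by omega)
  refine ⟨j - i, by omega, fun k => ?_⟩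
  rw [show k + (j - i) = k - i + j by ring, zpow_add, Equiv.Perm.mul_apply, ← hij,
    ← Equiv.Perm.mul_apply, ← zpow_add, sub_add_cancel]

variable {P : Type*} [PartialOrder P]

/-- Greedy choice: each earlier index excludes only its own finite row and column, so the infinite
set `S` always offers a new one. -/
theorem exists_induced_seq (Q : ℤ → ℤ → Prop) (hrow : ∀ i, {j | Q i j}.Finite)
    (hcol : ∀ j, {i | Q i j}.Finite) {S : Set ℤ} (hS : S.Infinite) :
    ∃ k : ℕ → ℤ, (∀ n, k n ∈ S) ∧ Function.Injective k ∧ ∀ m n, m ≠ n → ¬ Q (k m) (k n) := by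
  let r : ℤ → ℤ → Prop := fun a b => a ≠ b ∧ ¬ Q a b ∧ ¬ Q b a
  have : Std.Symm r := ⟨fun a b h => ⟨h.1.symm, h.2.2, h.2.1⟩⟩
  obtain ⟨k, hk, hr⟩ := exists_seq_of_forall_finset_exists' (· ∈ S) r fun s _ => by
    have hfin : (⋃ a ∈ s, ({a} ∪ {j | Q a j} ∪ {i | Q i a})).Finite :=
      s.finite_toSet.biUnion fun a _ => ((Set.finite_singleton a).union (hrow a)).union (hcol a)
    obtain ⟨b, hb, hbn⟩ := hS.exists_notMem_finite hfin
    simp only [Set.mem_iUnion, Set.mem_union, Set.mem_singleton_iff, Set.mem_ofPred_eq,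
      not_exists, not_or] at hbn
    exact ⟨b, hb, fun a ha => ⟨Ne.symm (hbn a ha).1.1, (hbn a ha).1.2, (hbn a ha).2⟩⟩
  refine ⟨k, hk, fun m n h => ?_, fun m n h => (hr h).2.1⟩
  by_contra hmn
  exact (hr hmn).1 h

theorem hasForbidden_of_matching (p q : ℤ → P) (hp : ∀ i j, p i ≤ p j → i = j)
    (hq : ∀ i j, q i ≤ q j → i = j) (hqp : ∀ i j, ¬ q j ≤ p i)
    (hrow : ∀ i, {j | p i ≤ q j}.Finite) (hcol : ∀ j, {i | p i ≤ q j}.Finite)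
    (hinf : {i | p i ≤ q i}.Infinite) : HasForbidden P := by
  obtain ⟨k, hk, hkinj, hne⟩ := exists_induced_seq (fun i j => p i ≤ q j) hrow hcol hinf
  have hiff (m n) : p (k m) ≤ q (k n) ↔ m = n :=
    ⟨fun h => by_contra fun hmn => hne m n hmn h, fun h => h ▸ hk m⟩
  -- Odd positions supply the two-element chains; the `p` at even positions, whose partners are
  -- dropped, supply the isolated antichain.
  refine hasForbidden_of_F3 (fun n => p (k (2 * n))) (fun n => p (k (2 * n + 1)))
    (fun n => q (k (2 * n + 1))) ?_ ?_ ?_ ?_ ?_ ?_ ?_ ?_ ?_ <;> intro i j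
  · exact fun h => by have := hkinj (hp _ _ h); omega
  · exact fun h => by have := hkinj (hp _ _ h); omega
  · exact fun h => by have := hkinj (hq _ _ h); omega
  · rw [hiff]; omega
  · exact hqp _ _
  · exact fun h => by have := hkinj (hp _ _ h); omega
  · exact fun h => by have := hkinj (hp _ _ h); omega
  · rw [hiff]; omega
  · exact hqp _ _

theorem hasForbidden_of_comatching (p q : ℤ → P) (hp : ∀ i j, p i ≤ p j → i = j)
    (hq : ∀ i j, q i ≤ q j → i = j) (hqp : ∀ i j, ¬ q j ≤ p i)
    (hrow : ∀ i, {j | ¬ p i ≤ q j}.Finite) (hcol : ∀ j, {i | ¬ p i ≤ q j}.Finite)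
    (hinf : {i | ¬ p i ≤ q i}.Infinite) : HasForbidden P := by
  obtain ⟨k, hk, hkinj, hne⟩ := exists_induced_seq (fun i j => ¬ p i ≤ q j) hrow hcol hinf
  have hiff (m n) : p (k m) ≤ q (k n) ↔ m ≠ n :=
    ⟨fun h hmn => hk m (by subst hmn; exact h), fun h => not_not.1 (hne m n h)⟩
  -- `α i = β j` must hold exactly when i = j ≤ 0: residues 1 and 2 mod 4 separate the two sides for
  -- positive indices, and residue 0 is shared by the others.
  let α : ℤ → ℕ := fun i => if 0 < i then 4 * i.natAbs + 1 else 4 * i.natAbs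
  let β : ℤ → ℕ := fun i => if 0 < i then 4 * i.natAbs + 2 else 4 * i.natAbs
  refine hasForbidden_of_F8 (fun i => p (k (α i))) (fun i => q (k (β i))) ?_ ?_ ?_ ?_ <;>
    intro i j
  · intro h
    have := hkinj (hp _ _ h)
    grind
  · intro h
    have := hkinj (hq _ _ h)
    grind
  · rw [hiff]
    grind
  · exact hqp _ _

/-- An element below infinitely many and not below infinitely many members of an antichain, and
above none of them. -/
theorem hasForbidden_of_split (p : P) (q : ℤ → P) (hq : ∀ i j, q i ≤ q j → i = j)
    (hqp : ∀ j, ¬ q j ≤ p) (h₁ : {j | p ≤ q j}.Infinite) (h₂ : {j | ¬ p ≤ q j}.Infinite) :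
    HasForbidden P := by
  have g₁ := h₁.natEmbedding
  have g₂ := h₂.natEmbedding
  refine hasForbidden_of_F2 p (fun n => q (g₂ n)) (fun n => q (g₁ n)) ?_ ?_ ?_ ?_ ?_ ?_ ?_
  · exact fun i j h => g₂.injective (Subtype.ext (hq _ _ h))
  · exact fun i j h => g₁.injective (Subtype.ext (hq _ _ h))
  · exact fun i => lt_of_le_not_ge (g₁ i).2 (hqp _)
  · exact fun i => (g₂ i).2
  · exact fun i => hqp _
  · exact fun i j h => (g₂ i).2 (hq _ _ h ▸ (g₁ j).2)
  · exact fun i j h => (g₂ i).2 (hq _ _ h ▸ (g₁ j).2)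

/-! ### Crossing sequences -/

/-- Two shift-monotone sequences with `x k < y k` for positive `k` only. -/
structure Crossing (x y : ℤ → P) : Prop where
  left : ShiftMono x x
  right : ShiftMono y y
  up : ShiftMono x y
  down : ShiftMono y x
  lt : ∀ k, 1 ≤ k → x k < y k
  not_le : ∀ k ≤ 0, ¬ x k ≤ y k

namespace Crossing

variable {x y : ℤ → P}

theorem dual (h : Crossing x y) :
    Crossing (fun i => OrderDual.toDual (y i)) (fun i => OrderDual.toDual (x i)) :=
  ⟨h.right.dual, h.left.dual, h.up.dual, h.down.dual, h.lt, h.not_le⟩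

/-- The offset 1 - m fixes the index 1 and keeps indices k ≤ 0 nonpositive, so the threshold of the
crossing stays in place. -/
theorem sample (h : Crossing x y) {m : ℤ} (hm : 0 < m) :
    Crossing (fun k => x (1 - m + m * k)) (fun k => y (1 - m + m * k)) where
  left := h.left.sample _ hm
  right := h.right.sample _ hm
  up := h.up.sample _ hm
  down := h.down.sample _ hm
  lt k hk := h.lt _ (by nlinarith)
  not_le k hk := h.not_le _ (by nlinarith)

theorem not_ge (h : Crossing x y) (k : ℤ) : ¬ y k ≤ x k := fun hk =>
  (h.lt _ (le_max_right k 1)).not_ge (h.down.of_le hk (le_max_left k 1) (by ring))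

end Crossing

theorem hasForbidden_of_antichain_antichain {x y : ℤ → P} (h : Crossing x y)
    (hx : ∀ i j, x i ≤ x j → i = j) (hy : ∀ i j, y i ≤ y j → i = j) : HasForbidden P := by
  have hxy := h.up
  have hnot (i j : ℤ) : ¬ y j ≤ x i := fun hji => by
    have h' := (h.down.add_nat i.natAbs.succ hji).trans (h.lt (i + i.natAbs.succ) (by omega)).le
    obtain rfl : j = i := by have := hy _ _ h'; omega
    exact h.not_ge _ hji
  by_contra hF
  -- A row or column that is neither finite nor cofinite gives `F2` or its dual.
  have hrow (i : ℤ) : {j | x i ≤ y j}.Finite ∨ {j | ¬ x i ≤ y j}.Finite := by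
    by_contra! h
    exact hF (hasForbidden_of_split (x i) y hy (hnot i) h.1 h.2)
  have hcol (j : ℤ) : {i | x i ≤ y j}.Finite ∨ {i | ¬ x i ≤ y j}.Finite := by
    by_contra! h
    exact hF (HasForbidden.of_dual (hasForbidden_of_split (P := Pᵒᵈ) (OrderDual.toDual (y j))
      (fun i => OrderDual.toDual (x i)) (fun i j h => (hx _ _ h).symm) (fun i => hnot i j)
      h.1 h.2))
  -- If column j were cofinite, almost every k ≤ i would have `x k ≤ y j`, which shifts forward to
  -- `x i ≤ y (i + j - k)`: infinitely many entries in the finite row i.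
  have col_of_row {i : ℤ} (h : {j | x i ≤ y j}.Finite) (j : ℤ) : {i | x i ≤ y j}.Finite := by
    refine (hcol j).resolve_right fun hj => ?_
    refine Set.Iic_infinite i (((h.image fun l => i + j - l).union hj).subset fun k hk => ?_)
    by_cases hkj : x k ≤ y j
    · exact Or.inl ⟨i + j - k, hxy.of_le hkj hk (by ring), by ring⟩
    · exact Or.inr hkj
  have col_of_row' {i : ℤ} (h : {j | ¬ x i ≤ y j}.Finite) (j : ℤ) :
      {i | ¬ x i ≤ y j}.Finite := by
    refine (hcol j).resolve_left fun hj => ?_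
    refine Set.Ici_infinite i (((h.image fun l => i + j - l).union hj).subset fun k hk => ?_)
    by_cases hkj : x k ≤ y j
    · exact Or.inr hkj
    · exact Or.inl ⟨i + j - k, fun h' => hkj (hxy.of_le h' hk (by ring)), by ring⟩
  have absurd_col (h₁ : {i | x i ≤ y 0}.Finite) (h₂ : {i | ¬ x i ≤ y 0}.Finite) : False :=
    Set.infinite_univ ((h₁.union h₂).subset fun i _ => em (x i ≤ y 0))
  rcases hrow 0 with hfin | hfin
  · refine hF (hasForbidden_of_matching x y hx hy hnot (fun i => ?_) (col_of_row hfin) ?_)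
    · exact (hrow i).resolve_right fun h' => absurd_col (col_of_row hfin 0) (col_of_row' h' 0)
    · exact (Set.Ici_infinite (1 : ℤ)).mono fun k hk => (h.lt k hk).le
  · refine hF (hasForbidden_of_comatching x y hx hy hnot (fun i => ?_) (col_of_row' hfin) ?_)
    · exact (hrow i).resolve_left fun h' => absurd_col (col_of_row h' 0) (col_of_row' hfin 0)
    · exact (Set.Iic_infinite (0 : ℤ)).mono fun k hk => h.not_le k hk

theorem hasForbidden_of_const_antichain {x y : ℤ → P} (h : Crossing x y)
    (hx : ∀ i j, x i = x j) (hy : ∀ i j, y i ≤ y j → i = j) : HasForbidden P := by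
  have hlt (j : ℤ) (hj : 1 ≤ j) : x 0 < y j := hx j 0 ▸ h.lt j hj
  have hnle (j : ℤ) (hj : j ≤ 0) : ¬ x 0 ≤ y j := hx j 0 ▸ h.not_le j hj
  refine hasForbidden_of_split (x 0) y hy (fun j hj => ?_)
    ((Set.Ici_infinite (1 : ℤ)).mono fun k hk => (hlt k hk).le)
    ((Set.Iic_infinite (0 : ℤ)).mono fun k hk => hnle k hk)
  have := hy _ _ (hj.trans (hlt (max 1 j + 1) (by omega)).le)
  omega

theorem hasForbidden_of_const_asc {x y : ℤ → P} (h : Crossing x y)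
    (hx : ∀ i j, x i = x j) (hy : StrictMono y) : HasForbidden P := by
  have hlt (j : ℤ) (hj : 1 ≤ j) : x 0 < y j := hx j 0 ▸ h.lt j hj
  have hnle (j : ℤ) (hj : j ≤ 0) : ¬ x 0 ≤ y j := hx j 0 ▸ h.not_le j hj
  refine hasForbidden_of_F5 (x 0) (fun n => y (-n)) (fun n => y (1 + n))
    (fun m n hmn => hy (by omega)) (fun m n hmn => hy (by omega)) (fun n => hnle _ (by omega))
    (fun n hn => h.not_ge (-n) (hx 0 (-n) ▸ hn)) (hlt _ (by simp)) (hy (by simp))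

theorem hasForbidden_of_antichain_asc {x y : ℤ → P} (h : Crossing x y)
    (hx : ∀ i j, x i ≤ x j → i = j) (hy : StrictMono y) : HasForbidden P := by
  refine hasForbidden_of_antichain_chain (fun n => x (-n)) (fun n => y n)
    (fun i j hij => by have := hx _ _ hij; omega) (fun m n hmn => hy (by omega)) fun i j hji => ?_
  -- The shift by i + 3 puts `x 1 < y 1` under this inequality, so `x 1 ≤ x 3` contradicts the
  -- antichain.
  have h₃ : y (j + i + 3) ≤ x 3 := h.down.of_le hji (by omega) (by ring)
  have := hx _ _ ((h.lt 1 le_rfl).le.trans ((hy.monotone (by omega)).trans h₃))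
  omega

theorem hasForbidden_of_antichain_desc {x y : ℤ → P} (h : Crossing x y)
    (hx : ∀ i j, x i ≤ x j → i = j) (hy : StrictAnti y) : HasForbidden P := by
  refine HasForbidden.of_dual (hasForbidden_of_F1 (P := Pᵒᵈ)
    (fun n => OrderDual.toDual (x (-n))) (fun n => OrderDual.toDual (y n))
    (fun i j hij => ?_) (fun m n hmn => hy (by omega)) (fun i j hji => ?_) fun i j hij => ?_)
  · have := hx _ _ hij
    omega
  · have h₁ : y (j + i + 1) ≤ x 1 := h.down.of_le hji (by omega) (by ring)
    have := hx _ _ ((h.lt (j + i + 2) (by omega)).le.trans ((hy.antitone (by omega)).trans h₁))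
    omega
  · exact h.not_le (-i) (by omega) (le_trans hij (hy.antitone (by omega)))

/-- If the two chains are not coinitial in each other on nonpositive indices, a term with nothing of
the other chain below it is the lone point of `F5`. If they are, the incomparable pairs `x j`, `y j`
give `F6`. -/
theorem hasForbidden_of_asc_asc {x y : ℤ → P} (h : Crossing x y) (hx : StrictMono x)
    (hy : StrictMono y) : HasForbidden P := by
  have hlt (i : ℤ) (hi : i ≤ 0) : x i < y 1 := (hx (by omega)).trans (h.lt 1 le_rfl)
  have hc : StrictMono fun n : ℕ => y (1 + n) := fun m n hmn => hy (by omega)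
  by_cases h₁ : ∃ j ≤ 0, ∀ i ≤ 0, ¬ x i ≤ y j
  · obtain ⟨j, hj, hij⟩ := h₁
    exact hasForbidden_of_F5 (y j) (fun n => x (j - n)) (fun n => y (1 + n))
      (fun m n hmn => hx (by omega)) hc
      (fun n hn => h.not_ge j (hn.trans (hx.monotone (by omega)))) (fun n => hij _ (by omega))
      (hy (by omega)) (by simpa using hlt j hj)
  by_cases h₂ : ∃ i ≤ 0, ∀ j ≤ 0, ¬ y j ≤ x i
  · obtain ⟨i, hi, hij⟩ := h₂
    exact hasForbidden_of_F5 (x i) (fun n => y (i - n)) (fun n => y (1 + n))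
      (fun m n hmn => hy (by omega)) hc
      (fun n hn => h.not_le i hi (hn.trans (hy.monotone (by omega)))) (fun n => hij _ (by omega))
      (by simpa using hlt i hi) (hy (by omega))
  push Not at h₁ h₂
  refine hasForbidden_of_pairs x y (fun n => y (1 + n)) (fun j hj => ⟨h.not_le j hj, h.not_ge j⟩)
    (fun j hj => ?_) hc (by simpa using hlt 0 le_rfl) (hy (by simp))
  obtain ⟨k, hk, hkj⟩ := h₁ j hj
  obtain ⟨l, hl, hlj⟩ := h₂ j hj
  exact ⟨min j (min k l) - 1, by omega, hx (by omega), (hx (by omega)).trans_le hkj,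
    (hy (by omega)).trans_le hlj, hy (by omega)⟩

/-- The point `y 0` decides: either some `x i` with i ≥ 1 is below it, and it is the lone point of a
dual `F5` made from the chain `x`, or it is incomparable to all of them and is the lone point of an
`F5`. -/
theorem hasForbidden_of_desc_asc {x y : ℤ → P} (h : Crossing x y) (hx : StrictAnti x)
    (hy : StrictMono y) : HasForbidden P := by
  have hlt (i j : ℤ) (hi : 1 ≤ i) (hj : 1 ≤ j) : x i < y j :=
    (hx.antitone hi).trans_lt ((h.lt 1 le_rfl).trans_le (hy.monotone hj))
  have hnot (i j : ℤ) : ¬ y j ≤ x i := fun hji =>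
    (hlt _ _ (by omega) (by omega)).not_ge (h.down.add_nat (i.natAbs + j.natAbs + 1) hji)
  by_cases h₁ : ∃ i, 1 ≤ i ∧ x i ≤ y 0
  · obtain ⟨i, hi, hi0⟩ := h₁
    exact HasForbidden.of_dual (hasForbidden_of_F5 (P := Pᵒᵈ) (OrderDual.toDual (y 0))
      (fun n => OrderDual.toDual (x (-n))) (fun n => OrderDual.toDual (x (i + n)))
      (fun m n hmn => hx (by omega)) (fun m n hmn => hx (by omega))
      (fun n hn => h.not_le 0 le_rfl (le_trans (hx.antitone (by omega)) hn))
      (fun n => hnot _ _) (lt_of_le_not_ge (by simpa using hi0) (hnot _ _)) (hx (by simp; omega)))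
  · push Not at h₁
    exact hasForbidden_of_F5 (y 0) (fun n => x (1 + n)) (fun n => y (1 + n))
      (fun m n hmn => hx (by omega)) (fun m n hmn => hy (by omega)) (fun n => hnot _ _)
      (fun n => h₁ _ (by omega)) (hy (by simp)) (hlt _ _ (by simp) (by simp))

/-! ### Tame sequences and the conclusion -/

/-- A sequence which is constant, strictly monotone, strictly antitone or an antichain. -/
def Tame (z : ℤ → P) : Prop :=
  (∀ i j, z i = z j) ∨ StrictMono z ∨ StrictAnti z ∨ ∀ i j, z i ≤ z j → i = j

theorem Tame.sample {z : ℤ → P} (h : Tame z) (b : ℤ) {m : ℤ} (hm : 0 < m) :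
    Tame fun k => z (b + m * k) := by
  rcases h with h | h | h | h
  · exact Or.inl fun i j => h _ _
  · exact Or.inr (Or.inl fun i j hij => h (by gcongr))
  · exact Or.inr (Or.inr (Or.inl fun i j hij => h (by gcongr)))
  · exact Or.inr (Or.inr (Or.inr fun i j hij =>
      mul_left_cancel₀ hm.ne' (add_left_cancel (h _ _ hij))))

theorem Crossing.hasForbidden {x y : ℤ → P} (h : Crossing x y) (hx : Tame x) (hy : Tame y) :
    HasForbidden P := by
  rcases hx with hx | hx | hx | hx <;> rcases hy with hy | hy | hy | hy
  · exact absurd (hx 0 1 ▸ hy 0 1 ▸ (h.lt 1 le_rfl).le) (h.not_le 0 le_rfl)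
  · exact hasForbidden_of_const_asc h hx hy
  · exact absurd (hx 1 0 ▸ (h.lt 1 le_rfl).le.trans (hy.antitone zero_le_one))
      (h.not_le 0 le_rfl)
  · exact hasForbidden_of_const_antichain h hx hy
  · exact absurd (hy 1 0 ▸ (hx.monotone zero_le_one).trans (h.lt 1 le_rfl).le)
      (h.not_le 0 le_rfl)
  · exact hasForbidden_of_asc_asc h hx hy
  · exact absurd ((hx.monotone zero_le_one).trans
      ((h.lt 1 le_rfl).le.trans (hy.antitone zero_le_one))) (h.not_le 0 le_rfl)
  · exact HasForbidden.of_dual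
      (hasForbidden_of_antichain_desc h.dual (fun i j hij => (hy _ _ hij).symm) hx)
  · exact HasForbidden.of_dual (hasForbidden_of_const_asc h.dual hy hx)
  · exact hasForbidden_of_desc_asc h hx hy
  · exact HasForbidden.of_dual (hasForbidden_of_asc_asc h.dual hy hx)
  · exact HasForbidden.of_dual
      (hasForbidden_of_antichain_asc h.dual (fun i j hij => (hy _ _ hij).symm) hx)
  · exact HasForbidden.of_dual
      (hasForbidden_of_const_antichain h.dual hy fun i j hij => (hx _ _ hij).symm)
  · exact hasForbidden_of_antichain_asc h hx hy
  · exact hasForbidden_of_antichain_desc h hx hy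
  · exact hasForbidden_of_antichain_antichain h hx hy

/-- One step `m` serves every offset `b`, because the two orbits must later be sampled along a
common progression whose offset is dictated by the crossing. -/
theorem exists_tame_sample (hF : ¬ HasForbidden P) {z : ℤ → P} (hz : ShiftMono z z)
    (hper : Function.Injective z ∨ ∃ m : ℤ, 0 < m ∧ ∀ i, z (i + m) = z i) :
    ∃ m : ℤ, 0 < m ∧ ∀ b, Tame fun k => z (b + m * k) := by
  rcases hper with hinj | ⟨m, hm, hper⟩
  · have hback (n : ℕ) (i j : ℤ) (h : z (i + n) ≤ z (j + n)) : z i ≤ z j := by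
      induction n with
      | zero => simpa using h
      | succ n ih =>
        refine ih (by_contra fun h' => hF (hasForbidden_of_single z hinj hz h' ?_))
        simpa [add_assoc] using h
    have hall {i j : ℤ} (h : z i ≤ z j) (k l : ℤ) (hkl : l - k = j - i) : z k ≤ z l := by
      refine hback (i - k).natAbs k l (hz.of_le h (by omega) (by omega))
    by_cases hanti : ∀ i j, z i ≤ z j → i = j
    · exact ⟨1, one_pos, fun b => Tame.sample (Or.inr (Or.inr (Or.inr hanti))) b one_pos⟩
    push Not at hanti
    obtain ⟨i, j, hij, hne⟩ := hanti
    rcases hne.lt_or_gt with hlt | hlt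
    · refine ⟨j - i, by omega, fun b => Or.inr (Or.inl (strictMono_int_of_lt_succ fun k => ?_))⟩
      refine lt_of_le_of_ne (hall hij _ _ (by ring)) fun he => ?_
      have := hinj he
      nlinarith
    · refine ⟨i - j, by omega, fun b =>
        Or.inr (Or.inr (Or.inl (strictAnti_int_of_succ_lt fun k => ?_)))⟩
      refine lt_of_le_of_ne (hall hij _ _ (by ring)) fun he => ?_
      have := hinj he
      nlinarith
  · refine ⟨m, hm, fun b => Or.inl ?_⟩
    have hconst (k : ℤ) : z (b + m * k) = z b := by
      induction k with
      | zero => simp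
      | succ k ih => rw [← ih, ← hper (b + m * k)]; congr 1; ring
      | pred k ih => rw [← ih, ← hper]; congr 1; ring
    exact fun i j => (hconst i).trans (hconst j).symm

theorem shiftMono_orbit {e : Equiv.Perm P} (he : Monotone e) (p q : P) :
    ShiftMono (fun i => (e ^ i) p) (fun i => (e ^ i) q) := fun i j h => by
  simpa only [add_comm _ (1 : ℤ), zpow_one_add, Equiv.Perm.mul_apply] using he h

theorem hasForbidden_of_not_reversible (hP : ¬ Reversible P) : HasForbidden P := by
  simp only [Reversible, not_forall] at hP
  obtain ⟨f, hf, hbij, hno⟩ := hP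
  obtain ⟨p, q, hpq, hnle⟩ : ∃ p q, f p ≤ f q ∧ ¬ p ≤ q := by
    by_contra! h
    exact hno ⟨⟨Equiv.ofBijective f hbij, fun {a b} => ⟨h a b, fun hab => hf hab⟩⟩, rfl⟩
  let e : Equiv.Perm P := Equiv.ofBijective f hbij
  have he : Monotone e := hf
  have hcross : Crossing (fun i => (e ^ i) p) (fun i => (e ^ i) q) := by
    refine ⟨shiftMono_orbit he _ _, shiftMono_orbit he _ _, shiftMono_orbit he _ _,
      shiftMono_orbit he _ _, fun k hk => lt_of_le_of_ne ?_ ?_, fun k hk h => hnle ?_⟩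
    · exact (shiftMono_orbit he p q).of_le (i := 1) (j := 1) (by simpa [e] using hpq) hk (by ring)
    · exact fun h => hnle ((e ^ k).injective h).le
    · simpa using (shiftMono_orbit he p q).of_le h hk (l := 0) (by ring)
  by_contra hF
  obtain ⟨m, hm, htame⟩ := exists_tame_sample hF hcross.left (orbit_injective_or_periodic e p)
  obtain ⟨n, hn, htame'⟩ := exists_tame_sample hF hcross.right (orbit_injective_or_periodic e q)
  refine hF (((hcross.sample hm).sample hn).hasForbidden ((htame _).sample _ hn) ?_)
  -- The double sample has step m * n and offset 1 - m + m * (1 - n), so for the second orbit it can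
  -- be read as step n followed by step m.
  convert (htame' (1 - m + m * (1 - n))).sample 0 hm using 4
  ring

end TwoSequences

end ReversiblePoset

open ReversiblePoset in
theorem theorem1 {P : Type*} [PartialOrder P] (hP : ¬ Reversible P) :
    ContainsCopyOrDual P F1 ∨ ContainsCopyOrDual P F2 ∨ ContainsCopyOrDual P F3 ∨
    ContainsCopyOrDual P F4 ∨ ContainsCopyOrDual P F5 ∨ ContainsCopyOrDual P F6 ∨
    ContainsCopyOrDual P F7 ∨ ContainsCopyOrDual P F8 := by
  exact hasForbidden_of_not_reversible hP
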